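/- For a set $\Omega\subset\mathbb{R}^n$ and $\bar x\in\Omega$, let $$N_\Omega(\bar x):=\big\{v\in\mathbb{R}^n\;\big|\;\exists\,x_k\to\bar x,\ w_k\in\Pi(x_k;\Omega),\ \alpha_k\ge 0\ \text{ with }\ \alpha_k(x_k-w_k)\to v\ \text{ as }\ k\to\infty\big\}$$ be the limiting normal cone, where $\Pi(x;\Omega)$ is the set of points of $\Omega$ nearest to $x$ in the Euclidean norm, and let $N_\Omega(\bar x):=\emptyset$ if $\bar x\notin\Omega$. Let $g_1,\dots,g_m:\mathbb{R}^n\to\mathbb{R}$ and $f:\mathbb{R}^n\times\mathbb{R}^d\to\mathbb{R}^n$ be continuous, let $A\subset\mathbb{R}^d$ be compact, and set $C:=\bigcap_{i=1}^m\{x\mid g_i(x)\ge 0\}$, $C_u:=C+u$ for $u\in\mathbb{R}^n$, and $f(x,A):=\{f(x,a)\mid a\in A\}$. Let $T\ge 0$ and $x(\cdot),u(\cdot)\in W^{1,2}([0,T];\mathbb{R}^n)$. **Proposition 4.1.** The controlled sweeping inclusion $$(1)\qquad -\dot x(t)\in N_{C_{u(t)}}\big(x(t)\big)-f\big(x(t),a(t)\big)\quad\text{for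 a.e. } t\in[0,T],$$ in which $a:[0,T]\to\mathbb{R}^d$ is a measurable control with $a(t)\in A$ for a.e. $t\in[0,T]$, is equivalent to the inclusion $$(2)\qquad \dot x(t)\in -N_{C_{u(t)}}\big(x(t)\big)+f\big(x(t),A\big)\quad\text{for a.e. } t\in[0,T],$$ which contains no explicit control, in the following sense. If (1) holds for some measurable control $a(\cdot)$ with $a(t)\in A$ for a.e. $t\in[0,T]$, then (2) holds. Conversely, if (2) holds, then there is a measurable control $a(\cdot)$ with $a(t)\in A$ for a.e. $t\in[0,T]$, which belongs to $L^2([0,T];\mathbb{R}^d)$, such that (1) holds. -/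

import Mathlib

open Filter Topology MeasureTheory Set
open scoped Pointwise

namespace Sweeping

/-- The Euclidean projector `Π(x; Ω)`: the set of points of `Ω` nearest to `x`. -/
def projector {n : ℕ} (Ω : Set (EuclideanSpace ℝ (Fin n))) (x : EuclideanSpace ℝ (Fin n)) :
    Set (EuclideanSpace ℝ (Fin n)) :=
  {w | w ∈ Ω ∧ ‖x - w‖ = Metric.infDist x Ω}

/-- The limiting (basic, Mordukhovich) normal cone `N_Ω(p)`; it is empty when `p ∉ Ω`. -/
def normalCone {n : ℕ} (Ω : Set (EuclideanSpace ℝ (Fin n))) (p : EuclideanSpace ℝ (Fin n)) :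
    Set (EuclideanSpace ℝ (Fin n)) :=
  {v | p ∈ Ω ∧ ∃ (y w : ℕ → EuclideanSpace ℝ (Fin n)) (α : ℕ → ℝ),
    Tendsto y atTop (𝓝 p) ∧ (∀ k, w k ∈ projector Ω (y k)) ∧ (∀ k, 0 ≤ α k) ∧
      Tendsto (fun k => α k • (y k - w k)) atTop (𝓝 v)}

/-- The set `C = ⋂ i, C_i` with `C_i = {x | 0 ≤ g_i x}`. -/
def constraintSet {n m : ℕ} (g : Fin m → EuclideanSpace ℝ (Fin n) → ℝ) :
    Set (EuclideanSpace ℝ (Fin n)) :=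
  ⋂ i, {x | 0 ≤ g i x}

/-- The controlled moving set `C_u = C + u`. -/
def movingSet {n m : ℕ} (g : Fin m → EuclideanSpace ℝ (Fin n) → ℝ)
    (u : EuclideanSpace ℝ (Fin n)) : Set (EuclideanSpace ℝ (Fin n)) :=
  constraintSet g + {u}

/-- `x ∈ W^{1,2}([0,T]; ℝⁿ)`: `x` is absolutely continuous on `[0,T]` and its (a.e. existing)
derivative is square integrable there. Values outside `[0,T]` play no role. -/
def IsW12 {n : ℕ} (T : ℝ) (x : ℝ → EuclideanSpace ℝ (Fin n)) : Prop :=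
  AbsolutelyContinuousOnInterval x 0 T ∧ MemLp (deriv x) 2 (volume.restrict (Icc 0 T))

/-- `a` is a control on `[0,T]` with values in `A`: it is Lebesgue measurable on `[0,T]`
(that is, a.e. equal there to a Borel function) and `a t ∈ A` for a.e. `t ∈ [0,T]`. -/
def IsControl {d : ℕ} (A : Set (EuclideanSpace ℝ (Fin d))) (T : ℝ)
    (a : ℝ → EuclideanSpace ℝ (Fin d)) : Prop :=
  AEMeasurable a (volume.restrict (Icc 0 T)) ∧ ∀ᵐ t ∂(volume.restrict (Icc 0 T)), a t ∈ A

/-- The sweeping inclusion with explicit control,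
`ẋ(t) ∈ -N_{C_{u(t)}}(x(t)) + f(x(t), a(t))` for a.e. `t ∈ [0,T]`. -/
def ControlledInclusion {n m d : ℕ} (g : Fin m → EuclideanSpace ℝ (Fin n) → ℝ)
    (f : EuclideanSpace ℝ (Fin n) → EuclideanSpace ℝ (Fin d) → EuclideanSpace ℝ (Fin n))
    (T : ℝ) (x u : ℝ → EuclideanSpace ℝ (Fin n)) (a : ℝ → EuclideanSpace ℝ (Fin d)) : Prop :=
  ∀ᵐ t ∂(volume.restrict (Icc 0 T)),
    deriv x t ∈ -normalCone (movingSet g (u t)) (x t) + {f (x t) (a t)}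

/-- The sweeping inclusion without explicit control,
`ẋ(t) ∈ -N_{C_{u(t)}}(x(t)) + f(x(t), A)` for a.e. `t ∈ [0,T]`. -/
def ControlFreeInclusion {n m d : ℕ} (g : Fin m → EuclideanSpace ℝ (Fin n) → ℝ)
    (f : EuclideanSpace ℝ (Fin n) → EuclideanSpace ℝ (Fin d) → EuclideanSpace ℝ (Fin n))
    (A : Set (EuclideanSpace ℝ (Fin d)))
    (T : ℝ) (x u : ℝ → EuclideanSpace ℝ (Fin n)) : Prop :=
  ∀ᵐ t ∂(volume.restrict (Icc 0 T)),
    deriv x t ∈ -normalCone (movingSet g (u t)) (x t) + f (x t) '' A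

end Sweeping

/-! Passing from a control to the control-free inclusion is pointwise. For the converse,
`normalCone_add_singleton` moves the translation from the set to the point, so the inclusion asks
for some `a ∈ A` with `f x a - ẋ` in the normal cone of the fixed closed set `C` at `x - u`. This
condition is closed in `(x, u, ẋ, a)` jointly, as `f` is continuous and the cone has closed graph.
Compactness of `A` then gives a Borel selector `s`, and `a t = s (x t, u t, ẋ t)` is measurable and
bounded, hence in L². -/

/-- **Measurable selection** for closed graphs over a compact set: parametrize the compact set by
the Cantor set and select the point with the least parameter. -/
theorem exists_measurable_selection_of_isClosed {Z Y : Type*} [TopologicalSpace Z]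
    [MeasurableSpace Z] [BorelSpace Z] [MetricSpace Y] [MeasurableSpace Y] [BorelSpace Y]
    {A : Set Y} (hA : IsCompact A) (hne : A.Nonempty) {G : Set (Z × Y)} (hG : IsClosed G) :
    ∃ s : Z → Y, Measurable s ∧ (∀ z, s z ∈ A) ∧
      ∀ z, (∃ y ∈ A, (z, y) ∈ G) → (z, s z) ∈ G := by
  classical
  have : CompactSpace A := isCompact_iff_compactSpace.mp hA
  have : CompactSpace cantorSet := isCompact_iff_compactSpace.mp isCompact_cantorSet
  have : Nonempty A := hne.to_subtype
  obtain ⟨ψ, hψc, hψs⟩ := exists_nat_bool_continuous_surjective_of_compact A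
  obtain ⟨φ, hφc, hφs⟩ : ∃ φ : cantorSet → A, Continuous φ ∧ Function.Surjective φ :=
    ⟨ψ ∘ cantorSetHomeomorphNatToBool, hψc.comp cantorSetHomeomorphNatToBool.continuous,
      hψs.comp cantorSetHomeomorphNatToBool.surjective⟩
  let H : Set (Z × cantorSet) := {q | (q.1, (φ q.2 : Y)) ∈ G}
  have hH : IsClosed H := hG.preimage (by fun_prop)
  -- Projection along a compact factor is a closed map.
  have hproj : ∀ c : ℝ, IsClosed {z | ∃ r : cantorSet, (r : ℝ) ≤ c ∧ (z, r) ∈ H} := fun c ↦ by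
    have hc : IsClosed (H ∩ {q | (q.2 : ℝ) ≤ c}) :=
      hH.inter (isClosed_le (by fun_prop) continuous_const)
    convert isClosedMap_fst_of_compactSpace _ hc using 1
    ext z
    constructor
    · rintro ⟨r, h1, h2⟩
      exact ⟨(z, r), ⟨h2, h1⟩, rfl⟩
    · rintro ⟨⟨z', r⟩, ⟨h2, h1⟩, rfl⟩
      exact ⟨r, h1, h2⟩
  have hD : IsClosed {z | ∃ r : cantorSet, (z, r) ∈ H} := by
    convert hproj 1 using 1
    ext z
    exact exists_congr fun r ↦ (and_iff_right (cantorSet_subset_unitInterval r.2).2).symm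
  -- Fibres are compact, so a least parameter exists; the value `0` on empty fibres only makes the
  -- selector total.
  have hleast : ∀ z, ∃ r : cantorSet, if ∃ r' : cantorSet, (z, r') ∈ H
      then (z, r) ∈ H ∧ ∀ r' : cantorSet, (z, r') ∈ H → (r : ℝ) ≤ r'
      else r = ⟨0, zero_mem_cantorSet⟩ := fun z ↦ by
    split_ifs with hz
    · have hcpt : IsCompact {r : cantorSet | (z, r) ∈ H} :=
        (hH.preimage (Continuous.prodMk_right z)).isCompact
      obtain ⟨r, hr, hmin⟩ :=
        hcpt.exists_isMinOn hz (f := fun r : cantorSet ↦ (r : ℝ)) (by fun_prop)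
      exact ⟨r, hr, fun r' hr' ↦ hmin hr'⟩
    · exact ⟨_, rfl⟩
  choose s hs using hleast
  have hsm : Measurable fun z ↦ (s z : ℝ) := by
    refine measurable_of_Iic fun c ↦ ?_
    have : (fun z ↦ (s z : ℝ)) ⁻¹' Iic c =
        {z | ∃ r : cantorSet, (r : ℝ) ≤ c ∧ (z, r) ∈ H} ∪
          ({z | ∃ r : cantorSet, (z, r) ∈ H}ᶜ ∩ {_z | (0 : ℝ) ≤ c}) := by
      ext z
      have hz := hs z
      simp only [mem_preimage, mem_Iic, mem_union, mem_inter_iff, mem_compl_iff, mem_ofPred_eq]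
      split_ifs at hz with h
      · constructor
        · exact fun hc ↦ Or.inl ⟨s z, hc, hz.1⟩
        · rintro (⟨r, hr, hrH⟩ | ⟨h', -⟩)
          · exact (hz.2 r hrH).trans hr
          · exact absurd h h'
      · rw [hz]
        constructor
        · exact fun hc ↦ Or.inr ⟨h, hc⟩
        · rintro (⟨r, -, hrH⟩ | ⟨-, hc⟩)
          · exact absurd ⟨r, hrH⟩ h
          · exact hc
    rw [this]
    exact (hproj c).measurableSet.union (hD.measurableSet.compl.inter (MeasurableSet.const _))
  have hsm' : Measurable s := hsm.subtype_mk
  refine ⟨fun z ↦ (φ (s z) : Y), ?_, fun z ↦ (φ (s z)).2, ?_⟩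
  · exact (continuous_subtype_val.comp hφc).measurable.comp hsm'
  · rintro z ⟨y, hy, hyG⟩
    obtain ⟨r, hr⟩ := hφs ⟨y, hy⟩
    have hz := hs z
    rw [if_pos ⟨r, by simpa [H, hr] using hyG⟩] at hz
    exact hz.1

namespace Sweeping

variable {n : ℕ}

/-- The defining sequences are limits of points in the graph of proximal normals, so closedness of
the graph becomes visible. -/
theorem mem_normalCone_iff {Ω : Set (EuclideanSpace ℝ (Fin n))} {p v : EuclideanSpace ℝ (Fin n)} :
    v ∈ normalCone Ω p ↔ p ∈ Ω ∧ (p, v) ∈ closure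
      {q : EuclideanSpace ℝ (Fin n) × EuclideanSpace ℝ (Fin n) |
        ∃ w ∈ projector Ω q.1, ∃ α : ℝ, 0 ≤ α ∧ α • (q.1 - w) = q.2} := by
  refine and_congr_right fun _ ↦ ?_
  rw [mem_closure_iff_seq_limit]
  constructor
  · rintro ⟨y, w, α, hy, hw, hα, hlim⟩
    exact ⟨fun k ↦ (y k, α k • (y k - w k)), fun k ↦ ⟨w k, hw k, α k, hα k, rfl⟩,
      hy.prodMk_nhds hlim⟩
  · rintro ⟨q, hq, hlim⟩
    choose w hw α hα he using hq
    refine ⟨fun k ↦ (q k).1, w, α, (continuous_fst.tendsto _).comp hlim, hw, hα, ?_⟩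
    simp only [he]
    exact (continuous_snd.tendsto _).comp hlim

/-- The limiting normal cone of a closed set has closed graph. -/
theorem isClosed_graph_normalCone {Ω : Set (EuclideanSpace ℝ (Fin n))} (hΩ : IsClosed Ω) :
    IsClosed {q : EuclideanSpace ℝ (Fin n) × EuclideanSpace ℝ (Fin n) |
      q.2 ∈ normalCone Ω q.1} := by
  simp only [mem_normalCone_iff]
  exact (hΩ.preimage continuous_fst).inter isClosed_closure

theorem sub_mem_projector {Ω : Set (EuclideanSpace ℝ (Fin n))} {u y w : EuclideanSpace ℝ (Fin n)}
    (h : w ∈ projector (Ω + {u}) y) : w - u ∈ projector Ω (y - u) := by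
  obtain ⟨hw, hd⟩ := h
  rw [add_singleton] at hw hd
  obtain ⟨c, hc, rfl⟩ := hw
  refine ⟨by simpa using hc, ?_⟩
  have := Metric.infDist_image (isometry_add_right u) (x := y - u) (t := Ω)
  simp only [sub_add_cancel] at this
  rw [← this, ← hd]
  congr 1
  dsimp only
  abel

theorem sub_mem_normalCone {Ω : Set (EuclideanSpace ℝ (Fin n))} {u p v : EuclideanSpace ℝ (Fin n)}
    (h : v ∈ normalCone (Ω + {u}) p) : v ∈ normalCone Ω (p - u) := by
  obtain ⟨hp, y, w, α, hy, hw, hα, hlim⟩ := h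
  rw [add_singleton] at hp
  obtain ⟨c, hc, rfl⟩ := hp
  refine ⟨by simpa using hc, fun k ↦ y k - u, fun k ↦ w k - u, α, hy.sub_const u,
    fun k ↦ sub_mem_projector (hw k), hα, ?_⟩
  simpa using hlim

theorem normalCone_add_singleton (Ω : Set (EuclideanSpace ℝ (Fin n)))
    (u p : EuclideanSpace ℝ (Fin n)) :
    normalCone (Ω + {u}) p = normalCone Ω (p - u) := by
  refine Subset.antisymm (fun v ↦ sub_mem_normalCone) fun v hv ↦ ?_
  -- The reverse inclusion is the same one applied to the translate by `-u`.
  have hΩ : Ω + {u} + {-u} = Ω := by rw [add_assoc]; simp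
  have := sub_mem_normalCone (Ω := Ω + {u}) (u := -u) (p := p - u) (v := v) (by rwa [hΩ])
  simpa using this

theorem isClosed_constraintSet {m : ℕ} {g : Fin m → EuclideanSpace ℝ (Fin n) → ℝ}
    (hg : ∀ i, Continuous (g i)) : IsClosed (constraintSet g) :=
  isClosed_iInter fun i ↦ isClosed_le continuous_const (hg i)

theorem mem_neg_add_singleton_iff {E : Type*} [AddCommGroup E] {N : Set E} {v b : E} :
    v ∈ -N + {b} ↔ b - v ∈ N := by
  rw [add_singleton]
  constructor
  · rintro ⟨c, hc, rfl⟩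
    simpa using hc
  · intro h
    exact ⟨v - b, by simpa using h, by simp⟩

theorem mem_neg_add_image_iff {E F : Type*} [AddCommGroup E] {N : Set E} {v : E} {h : F → E}
    {A : Set F} : v ∈ -N + h '' A ↔ ∃ a ∈ A, v ∈ -N + {h a} := by
  simp only [Set.mem_add, mem_image, mem_singleton_iff]
  grind

end Sweeping

theorem proposition4p1 {n m d : ℕ}
    (g : Fin m → EuclideanSpace ℝ (Fin n) → ℝ) (hg : ∀ i, Continuous (g i))
    (f : EuclideanSpace ℝ (Fin n) → EuclideanSpace ℝ (Fin d) → EuclideanSpace ℝ (Fin n))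
    (hf : Continuous (fun p : EuclideanSpace ℝ (Fin n) × EuclideanSpace ℝ (Fin d) => f p.1 p.2))
    (A : Set (EuclideanSpace ℝ (Fin d))) (hA : IsCompact A)
    (T : ℝ) (hT : 0 ≤ T) (x u : ℝ → EuclideanSpace ℝ (Fin n))
    (hx : Sweeping.IsW12 T x) (hu : Sweeping.IsW12 T u) :
    (∀ a : ℝ → EuclideanSpace ℝ (Fin d), Sweeping.IsControl A T a →
      Sweeping.ControlledInclusion g f T x u a → Sweeping.ControlFreeInclusion g f A T x u) ∧
    (Sweeping.ControlFreeInclusion g f A T x u →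
      ∃ a : ℝ → EuclideanSpace ℝ (Fin d), Sweeping.IsControl A T a ∧
        MemLp a 2 (volume.restrict (Icc 0 T)) ∧
        Sweeping.ControlledInclusion g f T x u a) := by
  refine ⟨fun a ha h ↦ ?_, fun h ↦ ?_⟩
  · filter_upwards [ha.2, h] with t hat ht
    exact Sweeping.mem_neg_add_image_iff.mpr ⟨a t, hat, ht⟩
  rcases A.eq_empty_or_nonempty with rfl | hne
  -- For empty `A` the inclusion fails at every `t`, so `[0,T]` is null and any function serves.
  · have hfalse : ∀ᵐ _ ∂(volume.restrict (Icc 0 T)), False := by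
      filter_upwards [h] with t ht
      simp at ht
    refine ⟨fun _ ↦ 0, ⟨aemeasurable_const, hfalse.mono fun _ ↦ False.elim⟩,
      MemLp.zero, hfalse.mono fun _ ↦ False.elim⟩
  -- Taking `(x, u, ẋ)` rather than `t` as parameter makes the constraint closed although `ẋ` is
  -- merely measurable in `t`.
  let G : Set ((EuclideanSpace ℝ (Fin n) × EuclideanSpace ℝ (Fin n) × EuclideanSpace ℝ (Fin n)) ×
      EuclideanSpace ℝ (Fin d)) :=
    {q | f q.1.1 q.2 - q.1.2.2 ∈ Sweeping.normalCone (Sweeping.constraintSet g) (q.1.1 - q.1.2.1)}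
  have hG : IsClosed G := by
    have hf' : Continuous fun q : (EuclideanSpace ℝ (Fin n) × EuclideanSpace ℝ (Fin n) ×
        EuclideanSpace ℝ (Fin n)) × EuclideanSpace ℝ (Fin d) ↦ f q.1.1 q.2 :=
      hf.comp (continuous_fst.fst.prodMk continuous_snd)
    exact (Sweeping.isClosed_graph_normalCone (Sweeping.isClosed_constraintSet hg)).preimage
      (f := fun q : (EuclideanSpace ℝ (Fin n) × EuclideanSpace ℝ (Fin n) ×
        EuclideanSpace ℝ (Fin n)) × EuclideanSpace ℝ (Fin d) ↦
          (q.1.1 - q.1.2.1, f q.1.1 q.2 - q.1.2.2)) (by fun_prop)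
  obtain ⟨s, hsm, hsA, hsG⟩ := exists_measurable_selection_of_isClosed hA hne hG
  have haem : ∀ {y : ℝ → EuclideanSpace ℝ (Fin n)}, Sweeping.IsW12 T y →
      AEMeasurable y (volume.restrict (Icc 0 T)) := fun hy ↦ by
    have := hy.1.continuousOn
    rw [uIcc_of_le hT] at this
    exact this.aemeasurable measurableSet_Icc
  have ham : AEMeasurable (fun t ↦ s (x t, u t, deriv x t)) (volume.restrict (Icc 0 T)) :=
    hsm.comp_aemeasurable
      ((haem hx).prodMk ((haem hu).prodMk hx.2.aestronglyMeasurable.aemeasurable))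
  obtain ⟨K, hK⟩ := hA.isBounded.exists_norm_le
  refine ⟨_, ⟨ham, ae_of_all _ fun t ↦ hsA _⟩,
    MemLp.of_bound ham.aestronglyMeasurable K (ae_of_all _ fun t ↦ hK _ (hsA _)), ?_⟩
  filter_upwards [h] with t ht
  obtain ⟨a, haA, ha⟩ := Sweeping.mem_neg_add_image_iff.mp ht
  rw [Sweeping.mem_neg_add_singleton_iff, Sweeping.movingSet,
    Sweeping.normalCone_add_singleton] at ha ⊢
  exact hsG (x t, u t, deriv x t) ⟨a, haA, ha⟩
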